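/- Let $\mathbb D$ be the open unit disc. A function $\varphi\in L^1(\partial\mathbb D)$ belongs to $BMO$ if its mean oscillations $\frac1{|I|}\int_I|\varphi(e^{i\theta})-m_I(\varphi)|\,d\theta$, where $m_I(\varphi)=\frac1{|I|}\int_I\varphi(e^{i\theta})\,d\theta$, are bounded over all arcs $I\subset\partial\mathbb D$ of positive length, and to $VMO$ if, moreover, they tend to $0$ as $|I|\to0$. The space $VMOA$ consists of the analytic functions on $\mathbb D$ that are Poisson extensions of functions in $VMO$. **Proposition.** For every $r_0\in(0,1)$ there exist $f,g\in VMOA$ such that $$|f'(z)|+|g'(z)|\ \ge\ \frac1{(1-|z|)\,\bigl|\log(1-|z|)\bigr|}\qquad\text{for all } z \text{ with } r_0\le|z|<1,$$ and $$|f'(z)|+|g'(z)|\ \ge\ \frac1{(1-|z|)\,\max\{1,|\log(1-|z|)|\}}\qquad\text{for all } z\in\mathbb D .$$ Moreover, $f$ can be taken to be a positive constant multiple of the lacunary series: $f(z)=C\sum_{j=1}^\infty j^{-1}z^{q^j}$ with $q=100$ and some constant $C>0$. -/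

import Mathlib

open Set Metric MeasureTheory

noncomputable section

/-- The mean of `φ` over the arc `{e^{iθ} : a ≤ θ ≤ b}` of the unit circle. -/
def arcMean (φ : ℂ → ℂ) (a b : ℝ) : ℂ :=
  (b - a)⁻¹ • ∫ θ in a..b, φ (circleMap 0 1 θ)

/-- The mean oscillation of `φ` over the arc `{e^{iθ} : a ≤ θ ≤ b}` of the unit circle. -/
def arcOscillation (φ : ℂ → ℂ) (a b : ℝ) : ℝ :=
  (b - a)⁻¹ * ∫ θ in a..b, ‖φ (circleMap 0 1 θ) - arcMean φ a b‖

/-- Functions of bounded mean oscillation on the unit circle: `φ` is in `L¹` of the circle and its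
mean oscillations over all arcs of positive length are bounded. Only the values of `φ` on the unit
circle matter. -/
def IsBMO (φ : ℂ → ℂ) : Prop :=
  CircleIntegrable φ 0 1 ∧
    ∃ M : ℝ, ∀ a b : ℝ, a < b → b ≤ a + 2 * Real.pi → arcOscillation φ a b ≤ M

/-- Functions of vanishing mean oscillation on the unit circle: functions in `BMO` whose mean
oscillation over an arc tends to `0` as the length of the arc tends to `0`. -/
def IsVMO (φ : ℂ → ℂ) : Prop :=
  IsBMO φ ∧
    ∀ ε : ℝ, 0 < ε → ∃ δ : ℝ, 0 < δ ∧ ∀ a b : ℝ, a < b → b ≤ a + 2 * Real.pi → b - a < δ →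
      arcOscillation φ a b < ε

/-- The Poisson extension of a function on the unit circle to the unit disc,
`z ↦ (1 / 2π) ∫ (1 - |z|²) / |e^{iθ} - z|² φ(e^{iθ}) dθ`. -/
def poissonExtension (φ : ℂ → ℂ) (z : ℂ) : ℂ :=
  Real.circleAverage (fun w => poissonKernel 0 z w • φ w) 0 1

/-- The space `VMOA` of functions that are analytic in the open unit disc and are there the Poisson
extension of a `VMO` function on the unit circle. The values of `f` outside the disc are ignored. -/
def IsVMOA (f : ℂ → ℂ) : Prop :=
  AnalyticOnNhd ℂ f (ball 0 1) ∧
    ∃ φ : ℂ → ℂ, IsVMO φ ∧ ∀ z ∈ ball (0 : ℂ) 1, f z = poissonExtension φ z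

end

/-!
Both functions are lacunary series `A z + ∑ C / k z ^ (N 100 ^ k)`, with `A = 0`, `N = 1` for `f` and
`A = 10 C`, `N = 10` for `g`.

*Membership in `VMOA`.* The coefficients are square summable, so the partial sums converge in `L¹` of
the circle to some `φ`; by the Poisson formula for polynomials and `tendsto_poissonExtension`, the
Poisson extension of `φ` is the series. Mean oscillations pass to the limit
(`arcOscillation_le_of_tendsto`), so only the partial sums have to be estimated, on an arc of length
between `2π / (N 100 ^ (K + 1))` and `2π / (N 100 ^ K)` (`arcOscillation_lacunaryPoly_le`). The terms
with `k ≤ K` are Lipschitz with a constant of order `N 100 ^ K / K`, and oscillate by `O(1 / K)`. The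
frequencies of the other terms are multiples of `N 100 ^ (K + 1)`; their sum is therefore periodic
with a period not longer than the arc, and by Parseval's identity its mean modulus is of order
`(∑_{k > K} 1 / k²) ^ (1 / 2)`. Both contributions tend to `0` as `K → ∞`.

*Lower bound.* Let `|z| = exp (-s)`. If `1 / 10 ≤ s N 100 ^ k ≤ 1`, the `k`-th term dominates the
derivative (`le_norm_deriv_lacunarySeries`): the earlier terms have geometrically growing
coefficients, and the later ones are killed by `exp (-s N 100 ^ j)`. So the derivative is at least of
order `N 100 ^ k / k`, which is comparable with the desired bound (`weight_le`). For `s ≤ 1 / 100`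
these windows, taken for `N = 1` and `N = 10`, leave no gap; for `s ≥ 1 / 100` the linear term of `g`
dominates. Multiplying both functions by a large constant makes the implied constant equal to `1`.
-/

open Filter Topology

/-! ### Mean oscillation over arcs -/

/-- A circle integrable function is integrable over every arc. -/
theorem CircleIntegrable.intervalIntegrable_arc {φ : ℂ → ℂ} (h : CircleIntegrable φ 0 1)
    (a b : ℝ) : IntervalIntegrable (fun θ => φ (circleMap 0 1 θ)) volume a b := by
  have hp : Function.Periodic (fun θ => φ (circleMap 0 1 θ)) (2 * Real.pi) := fun θ => by
    simp [periodic_circleMap 0 1 θ]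
  exact hp.intervalIntegrable₀ Real.two_pi_pos.ne' h a b

/-- Replacing `φ` by `ψ` changes a mean oscillation by at most twice the mean of `‖φ - ψ‖`. -/
theorem arcOscillation_le_add {φ ψ : ℂ → ℂ} (hφ : CircleIntegrable φ 0 1)
    (hψ : CircleIntegrable ψ 0 1) {a b : ℝ} (hab : a < b) :
    arcOscillation φ a b ≤ arcOscillation ψ a b +
      2 * ((b - a)⁻¹ * ∫ θ in a..b, ‖φ (circleMap 0 1 θ) - ψ (circleMap 0 1 θ)‖) := by
  have h1 := hφ.intervalIntegrable_arc a b
  have h2 := hψ.intervalIntegrable_arc a b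
  have hpos : 0 < b - a := sub_pos.2 hab
  set D := ∫ θ in a..b, ‖φ (circleMap 0 1 θ) - ψ (circleMap 0 1 θ)‖ with hD
  have hm : ‖arcMean φ a b - arcMean ψ a b‖ ≤ (b - a)⁻¹ * D := by
    unfold arcMean
    rw [← smul_sub, ← intervalIntegral.integral_sub h1 h2, norm_smul, Real.norm_of_nonneg
      (inv_nonneg.2 hpos.le)]
    gcongr
    exact intervalIntegral.norm_integral_le_integral_norm hab.le
  have hc : ∀ c : ℂ, IntervalIntegrable (fun _ : ℝ => c) volume a b :=
    fun c => intervalIntegrable_const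
  have key : ∫ θ in a..b, ‖φ (circleMap 0 1 θ) - arcMean φ a b‖ ≤
      (∫ θ in a..b, ‖ψ (circleMap 0 1 θ) - arcMean ψ a b‖) + D + D := by
    calc ∫ θ in a..b, ‖φ (circleMap 0 1 θ) - arcMean φ a b‖
        ≤ ∫ θ in a..b, (‖ψ (circleMap 0 1 θ) - arcMean ψ a b‖ +
          ‖φ (circleMap 0 1 θ) - ψ (circleMap 0 1 θ)‖ + (b - a)⁻¹ * D) := by
          refine intervalIntegral.integral_mono_on hab.le (h1.sub (hc _)).norm
            (((h2.sub (hc _)).norm.add (h1.sub h2).norm).add intervalIntegrable_const) ?_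
          intro θ _
          have e : φ (circleMap 0 1 θ) - arcMean φ a b =
              (ψ (circleMap 0 1 θ) - arcMean ψ a b) +
              (φ (circleMap 0 1 θ) - ψ (circleMap 0 1 θ)) -
              (arcMean φ a b - arcMean ψ a b) := by ring
          rw [e]
          exact (norm_sub_le _ _).trans (add_le_add (norm_add_le _ _) hm)
      _ = _ := by
          rw [intervalIntegral.integral_add ((h2.sub (hc _)).norm.add (h1.sub h2).norm)
            intervalIntegrable_const, intervalIntegral.integral_add (h2.sub (hc _)).norm
            (h1.sub h2).norm, intervalIntegral.integral_const, smul_eq_mul, ← mul_assoc,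
            mul_inv_cancel₀ hpos.ne', one_mul]
  unfold arcOscillation
  calc _ ≤ (b - a)⁻¹ * ((∫ θ in a..b, ‖ψ (circleMap 0 1 θ) - arcMean ψ a b‖) + D + D) := by
        gcongr
    _ = _ := by ring

theorem arcOscillation_le_of_lipschitz {ψ : ℂ → ℂ} (hψ : CircleIntegrable ψ 0 1) {L a b : ℝ}
    (hab : a < b) (hL : 0 ≤ L)
    (h : ∀ s t : ℝ, ‖ψ (circleMap 0 1 s) - ψ (circleMap 0 1 t)‖ ≤ L * |s - t|) :
    arcOscillation ψ a b ≤ L * (b - a) := by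
  have h1 := hψ.intervalIntegrable_arc a b
  have hpos : 0 < b - a := sub_pos.2 hab
  have hpt : ∀ θ ∈ Icc a b, ‖ψ (circleMap 0 1 θ) - arcMean ψ a b‖ ≤ L * (b - a) := by
    intro θ hθ
    have e : ψ (circleMap 0 1 θ) - arcMean ψ a b =
        (b - a)⁻¹ • ∫ t in a..b, (ψ (circleMap 0 1 θ) - ψ (circleMap 0 1 t)) := by
      rw [intervalIntegral.integral_sub intervalIntegrable_const h1,
        intervalIntegral.integral_const, smul_sub, smul_smul, inv_mul_cancel₀ hpos.ne', one_smul,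
        arcMean]
    rw [e, norm_smul, Real.norm_of_nonneg (inv_nonneg.2 hpos.le), inv_mul_le_iff₀ hpos]
    have := intervalIntegral.norm_integral_le_of_norm_le_const (a := a) (b := b)
      (f := fun t => ψ (circleMap 0 1 θ) - ψ (circleMap 0 1 t)) (C := L * (b - a)) (by
        intro t ht
        rw [uIoc_of_le hab.le] at ht
        refine (h θ t).trans (mul_le_mul_of_nonneg_left ?_ hL)
        rw [abs_le]
        constructor <;> linarith [hθ.1, hθ.2, ht.1, ht.2])
    rw [abs_of_pos hpos] at this
    linarith
  unfold arcOscillation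
  rw [inv_mul_le_iff₀ hpos]
  calc _ ≤ ∫ _ in a..b, L * (b - a) :=
        intervalIntegral.integral_mono_on hab.le (h1.sub intervalIntegrable_const).norm
          intervalIntegrable_const hpt
    _ = _ := by rw [intervalIntegral.integral_const, smul_eq_mul]

/-! ### Mean values of trigonometric polynomials -/

/-- A nonnegative `2π`-periodic function has over an interval of length at least `2π` a mean that
is at most twice its mean over a period. -/
theorem integral_le_of_periodic {G : ℝ → ℝ} (hG : Continuous G) (h0 : ∀ t, 0 ≤ G t)
    (hp : Function.Periodic G (2 * Real.pi)) {a b : ℝ} (hab : 2 * Real.pi ≤ b - a) :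
    ∫ t in a..b, G t ≤ (b - a) / Real.pi * ∫ t in 0..2 * Real.pi, G t := by
  have hpi := Real.pi_pos
  set m : ℕ := ⌈(b - a) / (2 * Real.pi)⌉₊ with hm
  have h1 : (b - a) / (2 * Real.pi) ≤ m := Nat.le_ceil _
  have h2 : (m : ℝ) < (b - a) / (2 * Real.pi) + 1 :=
    Nat.ceil_lt_add_one (by apply div_nonneg <;> linarith)
  have h3 : 1 ≤ (b - a) / (2 * Real.pi) := by rw [le_div_iff₀ (by positivity)]; linarith
  have hI : ∀ s t, IntervalIntegrable G volume s t := fun s t => hG.intervalIntegrable s t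
  have hint : 0 ≤ ∫ t in 0..2 * Real.pi, G t :=
    intervalIntegral.integral_nonneg (by positivity) fun t _ => h0 t
  have h4 := hp.intervalIntegral_add_zsmul_eq (m : ℤ) a (fun s t => hI s t)
  have h5 : b ≤ a + (m : ℤ) • (2 * Real.pi) := by
    rw [div_le_iff₀ (by positivity)] at h1
    simp only [zsmul_eq_mul, Int.cast_natCast]
    linarith
  calc ∫ t in a..b, G t ≤ ∫ t in a..(a + (m : ℤ) • (2 * Real.pi)), G t :=
        intervalIntegral.integral_mono_interval le_rfl (by linarith) h5
          (Eventually.of_forall h0) (hI _ _)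
    _ = m * ∫ t in 0..2 * Real.pi, G t := by
        rw [h4, hp.intervalIntegral_add_eq a 0]; simp
    _ ≤ _ := by
        gcongr
        calc (m : ℝ) ≤ 2 * ((b - a) / (2 * Real.pi)) := by linarith
          _ = (b - a) / Real.pi := by field_simp

/-- Orthogonality of the monomials on the unit circle. -/
theorem integral_circleMap_pow_mul_conj (m n : ℕ) :
    ∫ t in 0..2 * Real.pi, circleMap 0 1 t ^ m * (starRingEnd ℂ) (circleMap 0 1 t ^ n) =
      if m = n then 2 * Real.pi else 0 := by
  have e : ∀ t : ℝ, circleMap 0 1 t ^ m * (starRingEnd ℂ) (circleMap 0 1 t ^ n) =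
      Complex.exp ((((m : ℂ) - n) * Complex.I) * t) := by
    intro t
    simp only [circleMap, zero_add, Complex.ofReal_one, one_mul, ← Complex.exp_conj,
      map_mul, Complex.conj_I, Complex.conj_ofReal, map_natCast, ← Complex.exp_nat_mul,
      ← Complex.exp_add]
    congr 1
    ring
  simp_rw [e]
  split_ifs with h
  · subst h; simp
  · have hne : ((m : ℂ) - n) * Complex.I ≠ 0 :=
      mul_ne_zero (sub_ne_zero.2 (by exact_mod_cast h)) Complex.I_ne_zero
    rw [integral_exp_mul_complex hne]
    have : Complex.exp (((m : ℂ) - n) * Complex.I * ((2 * Real.pi : ℝ) : ℂ)) = 1 := by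
      rw [Complex.exp_eq_one_iff]
      exact ⟨(m : ℤ) - n, by push_cast; ring⟩
    rw [this]
    simp

/-- Parseval's identity for trigonometric polynomials. -/
theorem integral_norm_sq_sum_circleMap_pow {ι : Type*} (s : Finset ι) (c : ι → ℝ) (n : ι → ℕ)
    (hn : Function.Injective n) :
    ∫ t in 0..2 * Real.pi, ‖∑ j ∈ s, (c j : ℂ) * circleMap 0 1 t ^ n j‖ ^ 2 =
      2 * Real.pi * ∑ j ∈ s, c j ^ 2 := by
  classical
  have e : ∀ t : ℝ, ((‖∑ j ∈ s, (c j : ℂ) * circleMap 0 1 t ^ n j‖ ^ 2 : ℝ) : ℂ) =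
      ∑ j ∈ s, ∑ k ∈ s, ((c j : ℂ) * c k) *
        (circleMap 0 1 t ^ n j * (starRingEnd ℂ) (circleMap 0 1 t ^ n k)) := by
    intro t
    rw [Complex.ofReal_pow, ← Complex.mul_conj', map_sum, Finset.sum_mul_sum]
    refine Finset.sum_congr rfl fun j _ => Finset.sum_congr rfl fun k _ => ?_
    rw [map_mul, Complex.conj_ofReal]
    ring
  have hcont : ∀ j k, Continuous fun t : ℝ => ((c j : ℂ) * c k) *
      (circleMap 0 1 t ^ n j * (starRingEnd ℂ) (circleMap 0 1 t ^ n k)) := fun j k =>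
    continuous_const.mul (((continuous_circleMap 0 1).pow _).mul
      (Complex.continuous_conj.comp ((continuous_circleMap 0 1).pow _)))
  apply Complex.ofReal_injective
  rw [← intervalIntegral.integral_ofReal]
  simp_rw [e]
  rw [intervalIntegral.integral_finsetSum fun j _ =>
    (continuous_finsetSum s fun k _ => hcont j k).intervalIntegrable _ _]
  rw [Complex.ofReal_mul, Complex.ofReal_sum, Finset.mul_sum]
  refine Finset.sum_congr rfl fun j hj => ?_
  rw [intervalIntegral.integral_finsetSum fun k _ => (hcont j k).intervalIntegrable _ _]
  rw [Finset.sum_eq_single_of_mem j hj fun k _ hkj => ?_]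
  · rw [intervalIntegral.integral_const_mul, integral_circleMap_pow_mul_conj, if_pos rfl]
    push_cast
    ring
  · rw [intervalIntegral.integral_const_mul, integral_circleMap_pow_mul_conj,
      if_neg (hn.ne hkj.symm), Complex.ofReal_zero, mul_zero]

/-- The Cauchy–Schwarz inequality, in the form `2 δ x ≤ δ² + x²`, and Parseval's identity. -/
theorem integral_norm_sum_circleMap_pow_le {ι : Type*} (s : Finset ι) (c : ι → ℝ) (n : ι → ℕ)
    (hn : Function.Injective n) {δ : ℝ} (hδ : 0 < δ) (hs : ∑ j ∈ s, c j ^ 2 ≤ δ ^ 2) :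
    ∫ t in 0..2 * Real.pi, ‖∑ j ∈ s, (c j : ℂ) * circleMap 0 1 t ^ n j‖ ≤ 2 * Real.pi * δ := by
  have hcont : Continuous fun t : ℝ => ∑ j ∈ s, (c j : ℂ) * circleMap 0 1 t ^ n j :=
    continuous_finsetSum s fun j _ => continuous_const.mul ((continuous_circleMap 0 1).pow _)
  have hcont2 : Continuous fun t : ℝ =>
      (2 * δ)⁻¹ * ‖∑ j ∈ s, (c j : ℂ) * circleMap 0 1 t ^ n j‖ ^ 2 :=
    continuous_const.mul (hcont.norm.pow 2)
  have hpi := Real.pi_pos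
  calc _ ≤ ∫ t in 0..2 * Real.pi,
        (δ / 2 + (2 * δ)⁻¹ * ‖∑ j ∈ s, (c j : ℂ) * circleMap 0 1 t ^ n j‖ ^ 2) := by
        refine intervalIntegral.integral_mono_on (by positivity)
          (hcont.norm.intervalIntegrable _ _)
          ((continuous_const.add hcont2).intervalIntegrable _ _)
          fun t _ => ?_
        have := sq_nonneg (‖∑ j ∈ s, (c j : ℂ) * circleMap 0 1 t ^ n j‖ - δ)
        rw [inv_mul_eq_div, div_add_div _ _ (by norm_num) (by positivity),
          le_div_iff₀ (by positivity)]
        nlinarith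
    _ = 2 * Real.pi * (δ / 2) + (2 * δ)⁻¹ * (2 * Real.pi * ∑ j ∈ s, c j ^ 2) := by
        rw [intervalIntegral.integral_add intervalIntegrable_const
          (hcont2.intervalIntegrable _ _),
          intervalIntegral.integral_const_mul, integral_norm_sq_sum_circleMap_pow s c n hn,
          intervalIntegral.integral_const, sub_zero, smul_eq_mul]
    _ ≤ 2 * Real.pi * (δ / 2) + (2 * δ)⁻¹ * (2 * Real.pi * δ ^ 2) := by gcongr
    _ = _ := by field_simp; ring

/-- A trigonometric polynomial all of whose frequencies are multiples of `p` is `2π/p`-periodic, so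
that its mean over an arc of length at least `2π/p` is controlled by its `L²` norm. -/
theorem integral_norm_sum_circleMap_pow_mul_le {ι : Type*} (s : Finset ι) (c : ι → ℝ)
    (n : ι → ℕ) (hn : Function.Injective n) {δ : ℝ} (hδ : 0 < δ)
    (hs : ∑ j ∈ s, c j ^ 2 ≤ δ ^ 2) {p : ℕ} (hp : 0 < p) {a b : ℝ}
    (hab : 2 * Real.pi ≤ (b - a) * p) :
    ∫ t in a..b, ‖∑ j ∈ s, (c j : ℂ) * circleMap 0 1 t ^ (p * n j)‖ ≤ (b - a) * (2 * δ) := by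
  have hp' : (0 : ℝ) < p := by exact_mod_cast hp
  set G : ℝ → ℝ := fun t => ‖∑ j ∈ s, (c j : ℂ) * circleMap 0 1 t ^ n j‖ with hG
  have hcont : Continuous G := (continuous_finsetSum s fun j _ =>
    continuous_const.mul ((continuous_circleMap 0 1).pow _)).norm
  have hper : Function.Periodic G (2 * Real.pi) := fun t => by
    simp only [hG, periodic_circleMap 0 1 t]
  have e : ∀ t : ℝ, ‖∑ j ∈ s, (c j : ℂ) * circleMap 0 1 t ^ (p * n j)‖ = G (t * p) := by
    intro t
    have : circleMap 0 1 (t * p) = circleMap 0 1 t ^ p := by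
      simp only [circleMap, zero_add, Complex.ofReal_one, one_mul, ← Complex.exp_nat_mul]
      congr 1
      push_cast
      ring
    simp only [hG, this, pow_mul]
  simp_rw [e]
  rw [intervalIntegral.integral_comp_mul_right _ hp'.ne', smul_eq_mul, inv_mul_le_iff₀ hp']
  have hpi := Real.pi_pos
  calc _ ≤ (b * p - a * p) / Real.pi * ∫ t in 0..2 * Real.pi, G t :=
        integral_le_of_periodic hcont (fun t => norm_nonneg _) hper (by linarith)
    _ ≤ (b * p - a * p) / Real.pi * (2 * Real.pi * δ) := by
        gcongr
        · apply div_nonneg _ hpi.le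
          linarith
        · exact integral_norm_sum_circleMap_pow_le s c n hn hδ hs
    _ = _ := by field_simp

/-! ### Limits in `L¹` of the circle -/

/-- Completeness of `L¹` of the circle, for sequences of continuous functions. -/
theorem exists_circleIntegrable_tendsto {S : ℕ → ℂ → ℂ} (hS : ∀ J, Continuous (S J)) {τ : ℕ → ℝ}
    (hτ : Tendsto τ atTop (𝓝 0)) (h : ∀ J K, J ≤ K →
      ∫ θ in 0..2 * Real.pi, ‖S K (circleMap 0 1 θ) - S J (circleMap 0 1 θ)‖ ≤ τ J) :
    ∃ φ : ℂ → ℂ, CircleIntegrable φ 0 1 ∧ Tendsto (fun J =>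
      ∫ θ in 0..2 * Real.pi, ‖φ (circleMap 0 1 θ) - S J (circleMap 0 1 θ)‖) atTop (𝓝 0) := by
  have h2pi : (0 : ℝ) ≤ 2 * Real.pi := Real.two_pi_pos.le
  have hcm : Measurable (circleMap 0 1) := (continuous_circleMap 0 1).measurable
  -- The length measure of the circle, as a measure on the plane.
  set μ : Measure ℂ := (volume.restrict (Ioc 0 (2 * Real.pi))).map (circleMap 0 1) with hμ
  have hint : ∀ F : ℂ → ℝ, AEStronglyMeasurable F μ →
      ∫ w, F w ∂μ = ∫ θ in 0..2 * Real.pi, F (circleMap 0 1 θ) := fun F hF => by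
    rw [intervalIntegral.integral_of_le h2pi, hμ, integral_map hcm.aemeasurable hF]
  have hnorm : ∀ (F : ℂ → ℂ) (hF : Integrable F μ),
      ‖hF.toL1 F‖ = ∫ θ in 0..2 * Real.pi, ‖F (circleMap 0 1 θ)‖ := fun F hF => by
    rw [L1.norm_eq_integral_norm, ← hint _ hF.aestronglyMeasurable.norm]
    exact integral_congr_ae (hF.coeFn_toL1.fun_comp norm)
  have hSi : ∀ J, Integrable (S J) μ := fun J => by
    rw [hμ, integrable_map_measure (hS J).aestronglyMeasurable hcm.aemeasurable]
    exact (((hS J).comp (continuous_circleMap 0 1)).intervalIntegrable 0 (2 * Real.pi)).1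
  have hdist : ∀ J K, J ≤ K → dist ((hSi J).toL1 (S J)) ((hSi K).toL1 (S K)) ≤ τ J := by
    intro J K hJK
    rw [dist_comm, dist_eq_norm, ← Integrable.toL1_sub, hnorm]
    exact h J K hJK
  obtain ⟨Φ, hΦ⟩ := cauchySeq_tendsto_of_complete (cauchySeq_of_le_tendsto_0' τ hdist hτ)
  have hΦi : Integrable Φ μ := L1.integrable_coeFn Φ
  refine ⟨Φ, ?_, ?_⟩
  · rw [CircleIntegrable, intervalIntegrable_iff_integrableOn_Ioc_of_le h2pi]
    exact (integrable_map_measure hΦi.aestronglyMeasurable hcm.aemeasurable).1 hΦi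
  · rw [tendsto_iff_norm_sub_tendsto_zero] at hΦ
    refine hΦ.congr fun J => ?_
    rw [norm_sub_rev]
    conv_lhs => rw [← Integrable.toL1_coeFn Φ hΦi]
    rw [← Integrable.toL1_sub, hnorm]
    rfl

theorem abs_poissonKernel_circleMap_le {z : ℂ} (hz : z ∈ ball (0 : ℂ) 1) (θ : ℝ) :
    |poissonKernel 0 z (circleMap 0 1 θ)| ≤ ((1 - ‖z‖) ^ 2)⁻¹ := by
  have hz1 : ‖z‖ < 1 := by simpa using hz
  have h0 : 0 < 1 - ‖z‖ := sub_pos.2 hz1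
  have hw : ‖circleMap 0 1 θ‖ = 1 := by simp
  have h1 : 1 - ‖z‖ ≤ ‖circleMap 0 1 θ - z‖ := by
    simpa [hw] using norm_sub_norm_le (circleMap 0 1 θ) z
  rw [poissonKernel_def]
  simp only [sub_zero, hw]
  have h2 : 0 ≤ 1 ^ 2 - ‖z‖ ^ 2 := by nlinarith [norm_nonneg z]
  rw [abs_of_nonneg (by positivity), div_eq_mul_inv]
  calc _ ≤ 1 * ((1 - ‖z‖) ^ 2)⁻¹ := by
        gcongr
        nlinarith [norm_nonneg z]
    _ = _ := one_mul _

theorem continuous_poissonKernel_circleMap {z : ℂ} (hz : z ∈ ball (0 : ℂ) 1) :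
    Continuous fun θ : ℝ => poissonKernel 0 z (circleMap 0 1 θ) := by
  have hz1 : ‖z‖ < 1 := by simpa using hz
  simp only [poissonKernel_def, sub_zero]
  refine Continuous.div (by fun_prop) (by fun_prop) fun θ => ?_
  have hne : circleMap 0 1 θ - z ≠ 0 := by
    intro h
    rw [sub_eq_zero] at h
    rw [← h] at hz1
    simp at hz1
  exact pow_ne_zero _ (norm_ne_zero_iff.2 hne)

/-- `L¹` convergence of boundary values implies pointwise convergence of Poisson extensions. -/
theorem tendsto_poissonExtension {S : ℕ → ℂ → ℂ} {φ : ℂ → ℂ} (hS : ∀ J, Continuous (S J))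
    (hφ : CircleIntegrable φ 0 1) (h : Tendsto (fun J =>
      ∫ θ in 0..2 * Real.pi, ‖φ (circleMap 0 1 θ) - S J (circleMap 0 1 θ)‖) atTop (𝓝 0))
    {z : ℂ} (hz : z ∈ ball (0 : ℂ) 1) :
    Tendsto (fun J => poissonExtension (S J) z) atTop (𝓝 (poissonExtension φ z)) := by
  have h2pi : (0 : ℝ) ≤ 2 * Real.pi := Real.two_pi_pos.le
  have hP := continuous_poissonKernel_circleMap hz
  have hSi : ∀ J, CircleIntegrable (S J) 0 1 := fun J =>
    ((hS J).comp (continuous_circleMap 0 1)).intervalIntegrable _ _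
  have hi : ∀ ψ : ℂ → ℂ, CircleIntegrable ψ 0 1 → IntervalIntegrable (fun θ =>
      poissonKernel 0 z (circleMap 0 1 θ) • ψ (circleMap 0 1 θ)) volume 0 (2 * Real.pi) :=
    fun ψ hψ => IntervalIntegrable.continuousOn_smul hψ hP.continuousOn
  rw [tendsto_iff_norm_sub_tendsto_zero]
  have hlim := h.const_mul ((2 * Real.pi)⁻¹ * ((1 - ‖z‖) ^ 2)⁻¹)
  rw [mul_zero] at hlim
  refine squeeze_zero (fun _ => norm_nonneg _) (fun J => ?_) hlim
  rw [norm_sub_rev, poissonExtension, poissonExtension, Real.circleAverage_def,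
    Real.circleAverage_def, ← smul_sub, ← intervalIntegral.integral_sub (hi φ hφ) (hi _ (hSi J)),
    norm_smul, Real.norm_of_nonneg (inv_nonneg.2 h2pi), mul_assoc]
  gcongr
  rw [← intervalIntegral.integral_const_mul]
  refine intervalIntegral.norm_integral_le_of_norm_le h2pi (Eventually.of_forall fun θ _ => ?_)
    ((IntervalIntegrable.sub hφ (hSi J)).norm.const_mul _)
  rw [← smul_sub, norm_smul]
  gcongr
  exact abs_poissonKernel_circleMap_le hz θ

/-- A mean oscillation is lower semicontinuous with respect to `L¹` convergence. -/
theorem arcOscillation_le_of_tendsto {S : ℕ → ℂ → ℂ} {φ : ℂ → ℂ} (hS : ∀ J, Continuous (S J))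
    (hφ : CircleIntegrable φ 0 1) (h : Tendsto (fun J =>
      ∫ θ in 0..2 * Real.pi, ‖φ (circleMap 0 1 θ) - S J (circleMap 0 1 θ)‖) atTop (𝓝 0))
    {a b B : ℝ} (hab : a < b) (hab' : b ≤ a + 2 * Real.pi)
    (hB : ∀ᶠ J in atTop, arcOscillation (S J) a b ≤ B) : arcOscillation φ a b ≤ B := by
  have hpos : 0 < b - a := sub_pos.2 hab
  have hSi : ∀ J, CircleIntegrable (S J) 0 1 := fun J =>
    ((hS J).comp (continuous_circleMap 0 1)).intervalIntegrable _ _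
  refine ge_of_tendsto (by simpa using (h.const_mul (2 * (b - a)⁻¹)).const_add B)
    (hB.mono fun J hJ => ?_)
  have hd : CircleIntegrable (fun w => φ w - S J w) 0 1 := IntervalIntegrable.sub hφ (hSi J)
  have hper : Function.Periodic (fun θ => ‖φ (circleMap 0 1 θ) - S J (circleMap 0 1 θ)‖)
      (2 * Real.pi) := fun θ => by simp only [periodic_circleMap 0 1 θ]
  have hle : ∫ θ in a..b, ‖φ (circleMap 0 1 θ) - S J (circleMap 0 1 θ)‖ ≤
      ∫ θ in 0..2 * Real.pi, ‖φ (circleMap 0 1 θ) - S J (circleMap 0 1 θ)‖ := by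
    calc _ ≤ ∫ θ in a..(a + 2 * Real.pi), ‖φ (circleMap 0 1 θ) - S J (circleMap 0 1 θ)‖ :=
          intervalIntegral.integral_mono_interval le_rfl hab.le hab'
            (Eventually.of_forall fun θ => norm_nonneg _) (hd.intervalIntegrable_arc _ _).norm
      _ = _ := by rw [hper.intervalIntegral_add_eq a 0, zero_add]
  calc arcOscillation φ a b ≤ _ := arcOscillation_le_add hφ (hSi J) hab
    _ ≤ B + 2 * ((b - a)⁻¹ *
        ∫ θ in 0..2 * Real.pi, ‖φ (circleMap 0 1 θ) - S J (circleMap 0 1 θ)‖) := by gcongr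
    _ = _ := by ring

/-! ### Mean oscillation of lacunary polynomials -/

/-- The polynomial `A z + ∑ C / k z ^ (N 100 ^ k)`, summed over `1 ≤ k ≤ J`. -/
noncomputable def lacunaryPoly (A C : ℝ) (N J : ℕ) (z : ℂ) : ℂ :=
  A * z + ∑ j ∈ Finset.range J, (C : ℂ) * (((j : ℂ) + 1)⁻¹ * z ^ (N * 100 ^ (j + 1)))

theorem differentiable_lacunaryPoly (A C : ℝ) (N J : ℕ) :
    Differentiable ℂ (lacunaryPoly A C N J) := by
  unfold lacunaryPoly
  fun_prop

theorem sum_range_hundred_pow_div_le (K : ℕ) :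
    ∑ j ∈ Finset.range K, (100 : ℝ) ^ (j + 1) / (j + 1) ≤ 1 / 49 * (100 ^ (K + 1) / (K + 1)) := by
  induction K with
  | zero => norm_num
  | succ K ih =>
    rw [Finset.sum_range_succ]
    calc _ ≤ 1 / 49 * ((100 : ℝ) ^ (K + 1) / (K + 1)) + 100 ^ (K + 1) / (K + 1) := by gcongr
      _ = 1 / 49 * (100 ^ (K + 1) * (50 / (K + 1))) := by ring
      _ ≤ 1 / 49 * (100 ^ (K + 1) * (100 / ((K : ℝ) + 1 + 1))) := by
          gcongr ?_ * (_ * ?_)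
          rw [div_le_div_iff₀ (by positivity) (by positivity)]
          have : (0 : ℝ) ≤ K := Nat.cast_nonneg K
          linarith
      _ = _ := by push_cast; ring

theorem sum_Ico_inv_sq_le {K J : ℕ} (h : K ≤ J) :
    ∑ j ∈ Finset.Ico K J, (((j : ℝ) + 1)⁻¹) ^ 2 ≤ 2 / (K + 1) := by
  have key : ∑ j ∈ Finset.Ico K J, (((j : ℝ) + 1)⁻¹) ^ 2 ≤ 2 / (K + 1) - 2 / (J + 1) := by
    induction J, h using Nat.le_induction with
    | base => simp
    | succ J hJ ih =>
      rw [Finset.sum_Ico_succ_top hJ]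
      have : (((J : ℝ) + 1)⁻¹) ^ 2 ≤ 2 / (J + 1) - 2 / ((J : ℝ) + 1 + 1) := by
        have hJ0 : (0 : ℝ) ≤ J := Nat.cast_nonneg J
        rw [div_sub_div _ _ (by positivity) (by positivity), inv_pow, ← one_div,
          div_le_div_iff₀ (by positivity) (by positivity)]
        nlinarith
      push_cast
      linarith
  have : (0 : ℝ) ≤ 2 / (J + 1) := by positivity
  linarith

theorem norm_pow_sub_pow_le_of_norm_le_one {w v : ℂ} (hw : ‖w‖ ≤ 1) (hv : ‖v‖ ≤ 1) (n : ℕ) :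
    ‖w ^ n - v ^ n‖ ≤ n * ‖w - v‖ := by
  induction n with
  | zero => simp
  | succ n ih =>
    have e : w ^ (n + 1) - v ^ (n + 1) = w * (w ^ n - v ^ n) + (w - v) * v ^ n := by ring
    rw [e]
    calc _ ≤ ‖w‖ * ‖w ^ n - v ^ n‖ + ‖w - v‖ * ‖v‖ ^ n := by
          refine (norm_add_le _ _).trans ?_
          rw [norm_mul, norm_mul, norm_pow]
      _ ≤ 1 * (n * ‖w - v‖) + ‖w - v‖ * 1 := by
          gcongr
          exact pow_le_one₀ (norm_nonneg _) hv
      _ = _ := by push_cast; ring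

theorem norm_natCast_add_one_inv (j : ℕ) : ‖((j : ℂ) + 1)⁻¹‖ = ((j : ℝ) + 1)⁻¹ := by
  rw [norm_inv]
  congr 1
  exact_mod_cast Complex.norm_natCast (j + 1)

theorem lacunaryPoly_lipschitz {A C : ℝ} (hA : 0 ≤ A) (hC : 0 ≤ C) (N K : ℕ) (s t : ℝ) :
    ‖lacunaryPoly A C N K (circleMap 0 1 s) - lacunaryPoly A C N K (circleMap 0 1 t)‖ ≤
      (A + C * (N * ∑ j ∈ Finset.range K, (100 : ℝ) ^ (j + 1) / (j + 1))) * |s - t| := by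
  have hd : ‖circleMap 0 1 s - circleMap 0 1 t‖ ≤ |s - t| := by
    simpa [dist_eq_norm] using (lipschitzWith_circleMap 0 1).dist_le_mul s t
  have e : lacunaryPoly A C N K (circleMap 0 1 s) - lacunaryPoly A C N K (circleMap 0 1 t) =
      A * (circleMap 0 1 s - circleMap 0 1 t) + ∑ j ∈ Finset.range K, (C : ℂ) *
        (((j : ℂ) + 1)⁻¹ * (circleMap 0 1 s ^ (N * 100 ^ (j + 1)) -
          circleMap 0 1 t ^ (N * 100 ^ (j + 1)))) := by
    simp only [lacunaryPoly, mul_sub, Finset.sum_sub_distrib]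
    ring
  rw [e, add_mul]
  refine (norm_add_le _ _).trans (add_le_add ?_ ?_)
  · rw [norm_mul, Complex.norm_real, Real.norm_of_nonneg hA]
    gcongr
  · rw [Finset.mul_sum, Finset.mul_sum, Finset.sum_mul]
    refine norm_sum_le_of_le _ fun j _ => ?_
    rw [norm_mul, norm_mul, norm_natCast_add_one_inv, Complex.norm_real,
      Real.norm_of_nonneg hC]
    calc _ ≤ C * (((j : ℝ) + 1)⁻¹ * ((N * 100 ^ (j + 1) : ℕ) * |s - t|)) := by
          gcongr
          refine (norm_pow_sub_pow_le_of_norm_le_one (by simp) (by simp) _).trans ?_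
          gcongr
      _ = _ := by push_cast; ring

theorem lacunaryPoly_sub {A C : ℝ} {N K J : ℕ} (h : K ≤ J) (z : ℂ) :
    lacunaryPoly A C N J z - lacunaryPoly A C N K z = ∑ j ∈ Finset.Ico K J,
      ((C * ((j : ℝ) + 1)⁻¹ : ℝ) : ℂ) * z ^ (N * 100 ^ (j + 1)) := by
  rw [lacunaryPoly, lacunaryPoly, add_sub_add_left_eq_sub, ← Finset.sum_Ico_eq_sub _ h]
  refine Finset.sum_congr rfl fun j _ => ?_
  push_cast
  ring

theorem sum_Ico_sq_le {C : ℝ} {K J : ℕ} (h : K ≤ J) :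
    ∑ j ∈ Finset.Ico K J, (C * ((j : ℝ) + 1)⁻¹) ^ 2 ≤ (C * √(2 / (K + 1))) ^ 2 := by
  simp_rw [mul_pow]
  rw [← Finset.mul_sum, Real.sq_sqrt (by positivity)]
  gcongr
  exact sum_Ico_inv_sq_le h

/-- The partial sums are Cauchy in `L¹` of the circle. -/
theorem integral_norm_lacunaryPoly_sub_le {A C : ℝ} (hC : 0 < C) {N K J : ℕ} (hN : 0 < N)
    (h : K ≤ J) :
    ∫ θ in 0..2 * Real.pi, ‖lacunaryPoly A C N J (circleMap 0 1 θ) -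
      lacunaryPoly A C N K (circleMap 0 1 θ)‖ ≤ 2 * Real.pi * (C * √(2 / (K + 1))) := by
  simp_rw [lacunaryPoly_sub h]
  refine integral_norm_sum_circleMap_pow_le _ _ _ (fun i j hij => ?_) (by positivity)
    (sum_Ico_sq_le h)
  have h1 := Nat.eq_of_mul_eq_mul_left hN hij
  have h2 := Nat.pow_right_injective (by norm_num : 2 ≤ 100) h1
  omega

/-- The frequencies `N 100 ^ (j + 1)` with `j ≥ K` are multiples of `N 100 ^ (K + 1)`, so that the
`L²` bound holds on the scale of the arc as well. -/
theorem integral_arc_norm_lacunaryPoly_sub_le {A C : ℝ} (hC : 0 < C) {N K J : ℕ} (hN : 0 < N)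
    (h : K ≤ J) {a b : ℝ} (hab : 2 * Real.pi ≤ (b - a) * (N * 100 ^ (K + 1))) :
    ∫ θ in a..b, ‖lacunaryPoly A C N J (circleMap 0 1 θ) -
      lacunaryPoly A C N K (circleMap 0 1 θ)‖ ≤ (b - a) * (2 * (C * √(2 / (K + 1)))) := by
  have e : ∀ z, lacunaryPoly A C N J z - lacunaryPoly A C N K z = ∑ i ∈ Finset.range (J - K),
      ((C * ((↑(K + i) : ℝ) + 1)⁻¹ : ℝ) : ℂ) * z ^ (N * 100 ^ (K + 1) * 100 ^ i) := by
    intro z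
    rw [lacunaryPoly_sub h, Finset.sum_Ico_eq_sum_range]
    refine Finset.sum_congr rfl fun i _ => ?_
    congr 2
    ring
  simp_rw [e]
  refine integral_norm_sum_circleMap_pow_mul_le _ _ _
    (Nat.pow_right_injective (by norm_num : 2 ≤ 100)) (by positivity) ?_ (by positivity)
    (by exact_mod_cast hab)
  have := sum_Ico_sq_le (C := C) h
  rwa [Finset.sum_Ico_eq_sum_range] at this

/-- The part of the bound for the mean oscillation of `lacunaryPoly A C N J` that does not come from
the linear term. It is used for arcs of length between `2π / (N 100 ^ (K + 1))` and
`2π / (N 100 ^ K)`, with no upper limit if `K = 0`. -/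
noncomputable def oscBound (C : ℝ) (K : ℕ) : ℝ := 15 * C / (K + 1) + 4 * (C * √(2 / (K + 1)))

/-- The frequencies below the scale of the arc contribute a Lipschitz function, those above it a
function that is small in the mean. -/
theorem arcOscillation_lacunaryPoly_le {A C : ℝ} (hA : 0 ≤ A) (hC : 0 < C) {N K J : ℕ}
    (hN : 0 < N) (h : K ≤ J) {a b : ℝ} (hab : a < b)
    (h1 : 2 * Real.pi ≤ (b - a) * (N * 100 ^ (K + 1)))
    (h2 : K = 0 ∨ (b - a) * (N * 100 ^ K) ≤ 2 * Real.pi) :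
    arcOscillation (lacunaryPoly A C N J) a b ≤ A * (b - a) + oscBound C K := by
  have hpos : 0 < b - a := sub_pos.2 hab
  have hci : ∀ J, CircleIntegrable (lacunaryPoly A C N J) 0 1 := fun J =>
    ((differentiable_lacunaryPoly A C N J).continuous.comp
      (continuous_circleMap 0 1)).intervalIntegrable _ _
  have hlow := arcOscillation_le_of_lipschitz (hci K) hab (by positivity)
    (lacunaryPoly_lipschitz hA hC.le N K)
  have hsum : (b - a) * (N * ∑ j ∈ Finset.range K, (100 : ℝ) ^ (j + 1) / (j + 1)) ≤
      15 / (K + 1) := by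
    rcases h2 with rfl | h2
    · simp
    · calc _ ≤ (b - a) * (N * (1 / 49 * (100 ^ (K + 1) / (K + 1)))) := by
            gcongr
            exact sum_range_hundred_pow_div_le K
        _ = (b - a) * (N * 100 ^ K) * (100 / 49 / (K + 1)) := by ring
        _ ≤ 2 * Real.pi * (100 / 49 / (K + 1)) := by gcongr
        _ ≤ 2 * 3.15 * (100 / 49 / (K + 1)) := by
            gcongr
            exact Real.pi_lt_d2.le
        _ ≤ 15 / (K + 1) := by
            rw [← mul_div_assoc]
            gcongr
            norm_num
  have hhigh := integral_arc_norm_lacunaryPoly_sub_le (A := A) hC hN h h1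
  calc _ ≤ _ := arcOscillation_le_add (hci J) (hci K) hab
    _ ≤ (A + C * (N * ∑ j ∈ Finset.range K, (100 : ℝ) ^ (j + 1) / (j + 1))) * (b - a) +
        2 * ((b - a)⁻¹ * ((b - a) * (2 * (C * √(2 / (K + 1)))))) := by gcongr
    _ = A * (b - a) + C * ((b - a) * (N * ∑ j ∈ Finset.range K, (100 : ℝ) ^ (j + 1) / (j + 1))) +
        4 * (C * √(2 / (K + 1))) := by field_simp; ring
    _ ≤ A * (b - a) + C * (15 / (K + 1)) + 4 * (C * √(2 / (K + 1))) := by gcongr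
    _ = _ := by rw [oscBound]; ring

theorem tendsto_oscBound (C : ℝ) : Tendsto (oscBound C) atTop (𝓝 0) := by
  have h : ∀ c : ℝ, Tendsto (fun K : ℕ => c / ((K : ℝ) + 1)) atTop (𝓝 0) := fun c =>
    tendsto_const_nhds.div_atTop (tendsto_natCast_atTop_atTop.atTop_add tendsto_const_nhds)
  have h2 := ((h 2).sqrt.const_mul C).const_mul 4
  simp only [Real.sqrt_zero, mul_zero] at h2
  have h3 := (h (15 * C)).add h2
  rwa [add_zero] at h3

theorem oscBound_le_zero {C : ℝ} (hC : 0 ≤ C) (K : ℕ) : oscBound C K ≤ oscBound C 0 := by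
  have : (0 : ℝ) ≤ K := Nat.cast_nonneg K
  unfold oscBound
  gcongr <;> simp

/-- A limit of the polynomials `lacunaryPoly` in the disc belongs to `VMOA`. -/
theorem isVMOA_of_tendsto_lacunaryPoly {A C : ℝ} (hA : 0 ≤ A) (hC : 0 < C) {N : ℕ} (hN : 0 < N)
    {f : ℂ → ℂ} (hf : DifferentiableOn ℂ f (ball 0 1))
    (hlim : ∀ z ∈ ball (0 : ℂ) 1, Tendsto (fun J => lacunaryPoly A C N J z) atTop (𝓝 (f z))) :
    IsVMOA f := by
  refine ⟨hf.analyticOnNhd isOpen_ball, ?_⟩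
  have hcont : ∀ J, Continuous (lacunaryPoly A C N J) := fun J =>
    (differentiable_lacunaryPoly A C N J).continuous
  have hτ : Tendsto (fun K : ℕ => 2 * Real.pi * (C * √(2 / ((K : ℝ) + 1)))) atTop (𝓝 0) := by
    have h : Tendsto (fun K : ℕ => 2 / ((K : ℝ) + 1)) atTop (𝓝 0) :=
      tendsto_const_nhds.div_atTop (tendsto_natCast_atTop_atTop.atTop_add tendsto_const_nhds)
    simpa using (h.sqrt.const_mul C).const_mul (2 * Real.pi)
  obtain ⟨φ, hφ, hφlim⟩ := exists_circleIntegrable_tendsto hcont hτ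
    fun J K hJK => integral_norm_lacunaryPoly_sub_le hC hN hJK
  -- The frequency scale that matches the length of the arc.
  have hscale : ∀ a b : ℝ, a < b → ∃ K : ℕ, 2 * Real.pi ≤ (b - a) * (N * 100 ^ (K + 1)) ∧
      (K = 0 ∨ (b - a) * (N * 100 ^ K) ≤ 2 * Real.pi) := by
    intro a b hab
    have hpos : 0 < b - a := sub_pos.2 hab
    have hex : ∃ K : ℕ, 2 * Real.pi ≤ (b - a) * (N * 100 ^ (K + 1)) := by
      obtain ⟨K, hK⟩ := pow_unbounded_of_one_lt (2 * Real.pi / ((b - a) * N))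
        (by norm_num : (1 : ℝ) < 100)
      refine ⟨K, ?_⟩
      have hN' : (0 : ℝ) < N := by exact_mod_cast hN
      rw [div_lt_iff₀ (by positivity)] at hK
      have h100 : (100 : ℝ) ^ K ≤ 100 ^ (K + 1) := pow_le_pow_right₀ (by norm_num) (by omega)
      calc _ ≤ (100 : ℝ) ^ K * ((b - a) * N) := hK.le
        _ ≤ 100 ^ (K + 1) * ((b - a) * N) := by gcongr
        _ = _ := by ring
    classical
    refine ⟨Nat.find hex, Nat.find_spec hex, ?_⟩
    rcases Nat.eq_zero_or_pos (Nat.find hex) with h0 | h0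
    · exact Or.inl h0
    · right
      have := Nat.find_min hex (Nat.sub_lt h0 one_pos)
      rw [Nat.sub_add_cancel (show 1 ≤ _ from h0)] at this
      exact (not_le.1 this).le
  have hosc : ∀ a b : ℝ, a < b → b ≤ a + 2 * Real.pi → ∀ K : ℕ,
      2 * Real.pi ≤ (b - a) * (N * 100 ^ (K + 1)) →
      (K = 0 ∨ (b - a) * (N * 100 ^ K) ≤ 2 * Real.pi) →
      arcOscillation φ a b ≤ A * (b - a) + oscBound C K := fun a b hab hab' K h1 h2 =>
    arcOscillation_le_of_tendsto hcont hφ hφlim hab hab' ((eventually_ge_atTop K).mono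
      fun J hJ => arcOscillation_lacunaryPoly_le hA hC hN hJ hab h1 h2)
  refine ⟨φ, ⟨⟨hφ, A * (2 * Real.pi) + oscBound C 0, ?_⟩, ?_⟩, ?_⟩
  · intro a b hab hab'
    obtain ⟨K, h1, h2⟩ := hscale a b hab
    refine (hosc a b hab hab' K h1 h2).trans (add_le_add ?_ (oscBound_le_zero hC.le K))
    gcongr
    linarith
  · intro ε hε
    obtain ⟨K₀, hK₀⟩ := eventually_atTop.1
      ((tendsto_oscBound C).eventually (gt_mem_nhds (half_pos hε)))
    have hN' : (0 : ℝ) < N := by exact_mod_cast hN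
    have hpi := Real.pi_pos
    refine ⟨min (ε / (2 * (A + 1))) (2 * Real.pi / (N * 100 ^ K₀)), by positivity, ?_⟩
    intro a b hab hab' hlt
    have hpos : 0 < b - a := sub_pos.2 hab
    have hlt1 := hlt.trans_le (min_le_left _ _)
    have hlt2 := hlt.trans_le (min_le_right _ _)
    rw [lt_div_iff₀ (by positivity)] at hlt1 hlt2
    obtain ⟨K, h1, h2⟩ := hscale a b hab
    have hKK : K₀ ≤ K := by
      by_contra hcon
      have hle : (100 : ℝ) ^ (K + 1) ≤ 100 ^ K₀ := pow_le_pow_right₀ (by norm_num) (by omega)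
      have : (b - a) * (N * 100 ^ (K + 1)) ≤ (b - a) * (N * 100 ^ K₀) := by gcongr
      linarith
    have := hosc a b hab hab' K h1 h2
    have := hK₀ K hKK
    nlinarith
  · intro z hz
    have h1 : ∀ J, poissonExtension (lacunaryPoly A C N J) z = lacunaryPoly A C N J z := fun J =>
      (differentiable_lacunaryPoly A C N J).diffContOnCl.circleAverage_poissonKernel_smul hz
    have h2 := tendsto_poissonExtension hcont hφ hφlim hz
    simp_rw [h1] at h2
    exact tendsto_nhds_unique (hlim z hz) h2

/-! ### Lacunary series -/

/-- The lacunary series `A z + ∑ C / k z ^ (N 100 ^ k)`, summed over `k ≥ 1`. -/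
noncomputable def lacunarySeries (A C : ℝ) (N : ℕ) (z : ℂ) : ℂ :=
  A * z + ∑' j : ℕ, (C : ℂ) * (((j : ℂ) + 1)⁻¹ * z ^ (N * 100 ^ (j + 1)))

theorem norm_lacunary_term_le {C : ℝ} (hC : 0 ≤ C) {N : ℕ} (hN : 0 < N) {ρ : ℝ} (hρ : ρ < 1)
    (j : ℕ) {z : ℂ} (hz : ‖z‖ ≤ ρ) :
    ‖(C : ℂ) * (((j : ℂ) + 1)⁻¹ * z ^ (N * 100 ^ (j + 1)))‖ ≤ C * ρ ^ j := by
  have h0 : 0 ≤ ρ := (norm_nonneg z).trans hz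
  have hj : j ≤ N * 100 ^ (j + 1) := by
    calc j ≤ j + 1 := by omega
      _ ≤ 100 ^ (j + 1) := (Nat.lt_pow_self (by norm_num)).le
      _ ≤ N * 100 ^ (j + 1) := Nat.le_mul_of_pos_left _ hN
  rw [norm_mul, norm_mul, norm_pow, norm_natCast_add_one_inv, Complex.norm_real,
    Real.norm_of_nonneg hC]
  have h1 : ((j : ℝ) + 1)⁻¹ ≤ 1 := inv_le_one_of_one_le₀ (by linarith [Nat.cast_nonneg (α := ℝ) j])
  calc _ ≤ C * (1 * ρ ^ (N * 100 ^ (j + 1))) := by gcongr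
    _ ≤ C * ρ ^ j := by
      rw [one_mul]
      exact mul_le_mul_of_nonneg_left (pow_le_pow_of_le_one h0 hρ.le hj) hC

theorem hasSum_lacunarySeries (A : ℝ) {C : ℝ} (hC : 0 ≤ C) {N : ℕ} (hN : 0 < N) {z : ℂ}
    (hz : z ∈ ball (0 : ℂ) 1) :
    HasSum (fun j : ℕ => (C : ℂ) * (((j : ℂ) + 1)⁻¹ * z ^ (N * 100 ^ (j + 1))))
      (lacunarySeries A C N z - A * z) := by
  have hz1 : ‖z‖ < 1 := by simpa using hz
  rw [lacunarySeries, add_sub_cancel_left]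
  exact (Summable.of_norm_bounded
    ((summable_geometric_of_lt_one (norm_nonneg z) hz1).mul_left C)
    fun j => norm_lacunary_term_le hC hN hz1 j le_rfl).hasSum

theorem hasDerivAt_lacunarySeries (A : ℝ) {C : ℝ} (hC : 0 ≤ C) {N : ℕ} (hN : 0 < N) {z : ℂ}
    (hz : z ∈ ball (0 : ℂ) 1) :
    ∃ D : ℂ, HasDerivAt (lacunarySeries A C N) (A + D) z ∧
      HasSum (fun j : ℕ => (C : ℂ) * (((j : ℂ) + 1)⁻¹ *
        ((N * 100 ^ (j + 1) : ℕ) * z ^ (N * 100 ^ (j + 1) - 1)))) D := by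
  have hz1 : ‖z‖ < 1 := by simpa using hz
  obtain ⟨ρ, hzρ, hρ⟩ := exists_between hz1
  have hρ0 : 0 ≤ ρ := (norm_nonneg z).trans hzρ.le
  have hzb : z ∈ ball (0 : ℂ) ρ := by simpa using hzρ
  have hu : Summable fun j : ℕ => C * ρ ^ j := (summable_geometric_of_lt_one hρ0 hρ).mul_left C
  have hd : ∀ j : ℕ, DifferentiableOn ℂ (fun w : ℂ =>
      (C : ℂ) * (((j : ℂ) + 1)⁻¹ * w ^ (N * 100 ^ (j + 1)))) (ball 0 ρ) := fun j => by fun_prop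
  have hle : ∀ (j : ℕ) (w : ℂ), w ∈ ball (0 : ℂ) ρ →
      ‖(C : ℂ) * (((j : ℂ) + 1)⁻¹ * w ^ (N * 100 ^ (j + 1)))‖ ≤ C * ρ ^ j := fun j w hw =>
    norm_lacunary_term_le hC hN hρ j (by simpa using (mem_ball_zero_iff.1 hw).le)
  have h1 := (Complex.differentiableOn_tsum_of_summable_norm hu hd isOpen_ball
    hle).differentiableAt (isOpen_ball.mem_nhds hzb)
  have h2 := ((hasDerivAt_id z).const_mul (A : ℂ)).add h1.hasDerivAt
  rw [mul_one] at h2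
  refine ⟨_, h2, ?_⟩
  have h3 := Complex.hasSum_deriv_of_summable_norm hu hd isOpen_ball hle hzb
  have e : ∀ j : ℕ, deriv (fun w : ℂ => (C : ℂ) * (((j : ℂ) + 1)⁻¹ * w ^ (N * 100 ^ (j + 1)))) z =
      (C : ℂ) * (((j : ℂ) + 1)⁻¹ *
        ((N * 100 ^ (j + 1) : ℕ) * z ^ (N * 100 ^ (j + 1) - 1))) := fun j =>
    (((hasDerivAt_pow _ z).const_mul _).const_mul _).deriv
  simp_rw [e] at h3
  exact h3

theorem differentiableOn_lacunarySeries (A : ℝ) {C : ℝ} (hC : 0 ≤ C) {N : ℕ} (hN : 0 < N) :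
    DifferentiableOn ℂ (lacunarySeries A C N) (ball 0 1) := fun _ hz =>
  let ⟨_, h, _⟩ := hasDerivAt_lacunarySeries A hC hN hz
  h.differentiableAt.differentiableWithinAt

theorem isVMOA_lacunarySeries {A C : ℝ} (hA : 0 ≤ A) (hC : 0 < C) {N : ℕ} (hN : 0 < N) :
    IsVMOA (lacunarySeries A C N) := by
  refine isVMOA_of_tendsto_lacunaryPoly hA hC hN (differentiableOn_lacunarySeries A hC.le hN)
    fun z hz => ?_
  simpa [lacunaryPoly] using
    (hasSum_lacunarySeries A hC.le hN hz).tendsto_sum_nat.const_add ((A : ℂ) * z)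

/-! ### Lower bounds for the derivative -/

theorem hundred_pow_mul_exp_le {t : ℝ} (ht : 1 / 10 ≤ t) (i : ℕ) :
    (100 : ℝ) ^ (i + 1) * Real.exp (-(t * 100 ^ (i + 1))) ≤ 3 / 25 * (1 / 2) ^ i := by
  set u : ℝ := 100 ^ (i + 1) with hu
  have hu0 : 0 < u := by positivity
  -- `exp v ≥ v ^ 5 / 5!` at `v = u / 10`.
  have h1 : u ^ 5 / 12000000 ≤ Real.exp (t * u) := by
    have h2 := Real.pow_div_factorial_le_exp (x := u / 10) (by positivity) 5
    calc u ^ 5 / 12000000 = (u / 10) ^ 5 / (Nat.factorial 5 : ℝ) := by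
          norm_num [Nat.factorial]; ring
      _ ≤ _ := h2
      _ ≤ Real.exp (t * u) := Real.exp_le_exp.2 (by nlinarith)
  have h3 : (12000000 : ℝ) / u ^ 4 ≤ 3 / 25 * (1 / 2) ^ i := by
    have h4 : u ^ 4 = 100000000 * (100000000 : ℝ) ^ i := by
      rw [hu, ← pow_mul, show (100000000 : ℝ) = 100 ^ 4 by norm_num, ← pow_mul, ← pow_add]
      congr 1
      ring
    have h5 : (2 : ℝ) ^ i ≤ 100000000 ^ i := pow_le_pow_left₀ (by norm_num) (by norm_num) i
    rw [h4, div_le_iff₀ (by positivity)]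
    calc (12000000 : ℝ) = 3 / 25 * (1 / 2) ^ i * (100000000 * 2 ^ i) := by
          rw [one_div, inv_pow]; field_simp; norm_num
      _ ≤ _ := by gcongr
  rw [Real.exp_neg, ← div_eq_mul_inv]
  calc u / Real.exp (t * u) ≤ u / (u ^ 5 / 12000000) := by gcongr
    _ = 12000000 / u ^ 4 := by field_simp
    _ ≤ _ := h3

/-- If `|z| = exp (-s)` with `s N 100 ^ k` between `1/10` and `1`, where `k = K + 1`, the `k`-th
term dominates the derivative of the lacunary series. -/
theorem le_norm_deriv_lacunarySeries {A C : ℝ} (hA : 0 ≤ A) (hC : 0 < C) {N : ℕ} (hN : 0 < N)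
    (hAC : A ≤ C * N) {z : ℂ} {s : ℝ} (hs : ‖z‖ = Real.exp (-s)) (K : ℕ)
    (h1 : 1 / 10 ≤ s * (N * 100 ^ (K + 1))) (h2 : s * (N * 100 ^ (K + 1)) ≤ 1) :
    C * (N * 100 ^ (K + 1) / (K + 1)) / 20 ≤ ‖deriv (lacunarySeries A C N) z‖ := by
  have hN' : (0 : ℝ) < N := by exact_mod_cast hN
  have hs0 : 0 < s := by
    by_contra hcon
    have : s * (N * 100 ^ (K + 1)) ≤ 0 := mul_nonpos_of_nonpos_of_nonneg (not_lt.1 hcon)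
      (by positivity)
    linarith
  have hz1 : ‖z‖ < 1 := by rw [hs, Real.exp_lt_one_iff]; linarith
  have hz : z ∈ ball (0 : ℂ) 1 := by simpa using hz1
  obtain ⟨D, hD, hsum⟩ := hasDerivAt_lacunarySeries A hC.le hN hz
  rw [hD.deriv]
  set X : ℝ := C * (N * 100 ^ (K + 1) / (K + 1)) with hX
  have hX0 : 0 < X := by positivity
  set e : ℕ → ℂ := fun j => z * ((C : ℂ) * (((j : ℂ) + 1)⁻¹ *
    ((N * 100 ^ (j + 1) : ℕ) * z ^ (N * 100 ^ (j + 1) - 1)))) with he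
  have hes : HasSum e (z * D) := hsum.mul_left z
  have hen : ∀ j, ‖e j‖ = C * (N * (100 ^ (j + 1) / (j + 1))) *
      Real.exp (-(s * (N * 100 ^ (j + 1)))) := by
    intro j
    have hpos : 0 < N * 100 ^ (j + 1) := by positivity
    have e1 : e j = (C : ℂ) * (((j : ℂ) + 1)⁻¹ * ((N * 100 ^ (j + 1) : ℕ) *
        z ^ (N * 100 ^ (j + 1)))) := by
      rw [he, ← mul_pow_sub_one hpos.ne' z]
      ring
    rw [e1, norm_mul, norm_mul, norm_mul, norm_natCast_add_one_inv, Complex.norm_real,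
      Real.norm_of_nonneg hC.le, Complex.norm_natCast, norm_pow, hs, ← Real.exp_nat_mul]
    have : ((N * 100 ^ (j + 1) : ℕ) : ℝ) * -s = -(s * (N * 100 ^ (j + 1))) := by push_cast; ring
    rw [this]
    push_cast
    ring
  have hmain : X * (9 / 25) ≤ ‖e K‖ := by
    rw [hen, hX]
    have : (9 / 25 : ℝ) ≤ Real.exp (-(s * (N * 100 ^ (K + 1)))) := by
      refine le_trans ?_ (Real.exp_le_exp.2 (neg_le_neg h2))
      have := Real.exp_neg_one_gt_d9
      linarith
    rw [mul_div_assoc]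
    gcongr
  have hlow : ‖∑ j ∈ Finset.range K, e j‖ ≤ X * (1 / 49) := by
    calc _ ≤ ∑ j ∈ Finset.range K, C * (N * ((100 : ℝ) ^ (j + 1) / (j + 1))) := by
          refine norm_sum_le_of_le _ fun j _ => ?_
          rw [hen]
          refine mul_le_of_le_one_right (by positivity) (Real.exp_le_one_iff.2 ?_)
          have : 0 ≤ s * (N * 100 ^ (j + 1)) := by positivity
          linarith
      _ = C * (N * ∑ j ∈ Finset.range K, (100 : ℝ) ^ (j + 1) / (j + 1)) := by
          rw [Finset.mul_sum, Finset.mul_sum]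
      _ ≤ C * (N * (1 / 49 * (100 ^ (K + 1) / (K + 1)))) := by
          gcongr
          exact sum_range_hundred_pow_div_le K
      _ = _ := by rw [hX]; ring
  have htail : ‖z * D - ∑ j ∈ Finset.range (K + 1), e j‖ ≤ X * (6 / 25) := by
    have ht := (hasSum_nat_add_iff' (K + 1)).2 hes
    rw [← ht.tsum_eq]
    have hg : HasSum (fun i : ℕ => X * (3 / 25 * (1 / 2 : ℝ) ^ i)) (X * (3 / 25 * 2)) :=
      (hasSum_geometric_two.mul_left _).mul_left _
    have := tsum_of_norm_bounded (f := fun i => e (i + (K + 1))) hg fun i => ?_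
    · linarith
    · rw [hen]
      have hb := hundred_pow_mul_exp_le h1 i
      calc C * (N * ((100 : ℝ) ^ (i + (K + 1) + 1) / ((i + (K + 1) : ℕ) + 1))) *
            Real.exp (-(s * (N * 100 ^ (i + (K + 1) + 1))))
          ≤ C * (N * ((100 : ℝ) ^ (i + (K + 1) + 1) / ((K : ℝ) + 1))) *
            Real.exp (-(s * (N * 100 ^ (i + (K + 1) + 1)))) := by
            gcongr
            linarith
        _ = X * ((100 : ℝ) ^ (i + 1) *
            Real.exp (-(s * (N * 100 ^ (K + 1)) * 100 ^ (i + 1)))) := by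
            rw [hX, show s * (N * 100 ^ (K + 1)) * 100 ^ (i + 1) =
              s * (N * (100 : ℝ) ^ (i + (K + 1) + 1)) by ring]
            ring
        _ ≤ _ := by gcongr
  have hlin : ‖z * A‖ ≤ X * (1 / 100) := by
    have hb : (100 : ℝ) ≤ 100 ^ (K + 1) / (K + 1) := by
      rw [le_div_iff₀ (by positivity), pow_succ, mul_comm]
      gcongr
      exact_mod_cast (Nat.lt_pow_self (by norm_num : 1 < 100) : K < 100 ^ K)
    rw [norm_mul, Complex.norm_real, Real.norm_of_nonneg hA]
    calc ‖z‖ * A ≤ 1 * (C * N) := by gcongr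
      _ = C * (N * 100) * (1 / 100) := by ring
      _ ≤ C * (N * (100 ^ (K + 1) / (K + 1))) * (1 / 100) := by gcongr
      _ = _ := by rw [hX]; ring
  have hdec : e K = z * (A + D) - z * A - ∑ j ∈ Finset.range K, e j -
      (z * D - ∑ j ∈ Finset.range (K + 1), e j) := by
    rw [Finset.sum_range_succ]
    ring
  have htri : ‖e K‖ ≤ ‖z * (A + D)‖ + ‖z * A‖ + ‖∑ j ∈ Finset.range K, e j‖ +
      ‖z * D - ∑ j ∈ Finset.range (K + 1), e j‖ := by
    rw [hdec]
    exact (norm_sub_le _ _).trans (add_le_add_left ((norm_sub_le _ _).trans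
      (add_le_add_left (norm_sub_le _ _) _)) _)
  have hz' : ‖z * (A + D)‖ ≤ ‖A + D‖ := by
    rw [norm_mul]
    exact mul_le_of_le_one_left (norm_nonneg _) hz1.le
  linarith

/-- Away from the circle the linear term dominates the derivative. -/
theorem le_norm_deriv_lacunarySeries_of_norm_le {C : ℝ} (hC : 0 < C) {z : ℂ}
    (hz : ‖z‖ ≤ Real.exp (-(1 / 100))) :
    C ≤ ‖deriv (lacunarySeries (10 * C) C 10) z‖ := by
  have hz1 : ‖z‖ < 1 := hz.trans_lt (by rw [Real.exp_lt_one_iff]; norm_num)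
  obtain ⟨D, hD, hsum⟩ := hasDerivAt_lacunarySeries (10 * C) hC.le (N := 10) (by norm_num)
    (by simpa using hz1 : z ∈ ball (0 : ℂ) 1)
  rw [hD.deriv]
  have hexp : Real.exp (1 / 100) ≤ 2 := by
    have := Real.exp_bound_div_one_sub_of_interval (x := 1 / 100) (by norm_num) (by norm_num)
    norm_num at this ⊢
    linarith
  have hDle : ‖D‖ ≤ 20 * C * (3 / 25 * 2) := by
    rw [← hsum.tsum_eq]
    have hg : HasSum (fun i : ℕ => 20 * C * (3 / 25 * (1 / 2 : ℝ) ^ i)) (20 * C * (3 / 25 * 2)) :=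
      (hasSum_geometric_two.mul_left _).mul_left _
    refine tsum_of_norm_bounded hg fun j => ?_
    have hpow : ‖z‖ ^ (10 * 100 ^ (j + 1) - 1) ≤
        2 * Real.exp (-(1 / 10 * 100 ^ (j + 1))) := by
      calc _ ≤ Real.exp (-(1 / 100)) ^ (10 * 100 ^ (j + 1) - 1) := by gcongr
        _ = Real.exp (1 / 100) * Real.exp (-(1 / 10 * 100 ^ (j + 1))) := by
            have h1 : 1 ≤ 10 * 100 ^ (j + 1) := Nat.one_le_iff_ne_zero.2 (by positivity)
            rw [← Real.exp_nat_mul, ← Real.exp_add, Nat.cast_sub h1]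
            congr 1
            push_cast
            ring
        _ ≤ _ := by gcongr
    have hinv : ((j : ℝ) + 1)⁻¹ ≤ 1 :=
      inv_le_one_of_one_le₀ (by linarith [Nat.cast_nonneg (α := ℝ) j])
    rw [norm_mul, norm_mul, norm_mul, norm_natCast_add_one_inv, Complex.norm_real,
      Real.norm_of_nonneg hC.le, Complex.norm_natCast, norm_pow]
    calc _ ≤ C * (1 * ((10 * 100 ^ (j + 1) : ℕ) *
          (2 * Real.exp (-(1 / 10 * 100 ^ (j + 1)))))) := by gcongr
      _ = 20 * C * (100 ^ (j + 1) * Real.exp (-(1 / 10 * 100 ^ (j + 1)))) := by push_cast; ring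
      _ ≤ _ := by
          exact mul_le_mul_of_nonneg_left (hundred_pow_mul_exp_le le_rfl j) (by positivity)
  have h10 : ‖((10 * C : ℝ) : ℂ)‖ = 10 * C := by
    rw [Complex.norm_real, Real.norm_of_nonneg (by positivity)]
  have := norm_sub_le_norm_add ((10 * C : ℝ) : ℂ) D
  rw [h10] at this
  linarith

/-- In the window of the `k`-th term, `k = K + 1`, one has `1 - |z| ≈ 1 / n` with `n = N 100 ^ k`, and
`log n` is at least `k`. -/
theorem weight_le {r s : ℝ} (hr : r = Real.exp (-s)) {N : ℕ} (hN : 0 < N) (K : ℕ)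
    (h1 : 1 / 10 ≤ s * (N * 100 ^ (K + 1))) (h2 : s * (N * 100 ^ (K + 1)) ≤ 1) :
    1 / ((1 - r) * max 1 |Real.log (1 - r)|) ≤ 11 * (N * 100 ^ (K + 1) / (K + 1)) := by
  have hN' : (1 : ℝ) ≤ N := by exact_mod_cast hN
  set n : ℝ := N * 100 ^ (K + 1) with hn
  have hn0 : 0 < n := by positivity
  have hr0 : 0 < r := hr ▸ Real.exp_pos _
  have hlow : 1 / (11 * n) ≤ 1 - r := by
    have hb := one_add_mul_le_pow (show (-2 : ℝ) ≤ r - 1 by linarith) (N * 100 ^ (K + 1))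
    rw [add_sub_cancel, hr, ← Real.exp_nat_mul, ← hr] at hb
    push_cast at hb
    have he : Real.exp (N * 100 ^ (K + 1) * -s) ≤ 10 / 11 := by
      calc _ ≤ Real.exp (-(1 / 10)) := Real.exp_le_exp.2 (by linarith)
        _ = (Real.exp (1 / 10))⁻¹ := Real.exp_neg _
        _ ≤ (11 / 10)⁻¹ := by
            gcongr
            linarith [Real.add_one_le_exp (1 / 10 : ℝ)]
        _ = _ := by norm_num
    rw [div_le_iff₀ (by positivity)]
    linarith
  have hpos : 0 < 1 - r := lt_of_lt_of_le (by positivity) hlow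
  have hlog : (K : ℝ) + 1 ≤ |Real.log (1 - r)| := by
    have h100 : (1 : ℝ) ≤ Real.log 100 := by
      rw [Real.le_log_iff_exp_le (by norm_num)]
      linarith [Real.exp_one_lt_d9]
    have hs : 1 - r ≤ (100 ^ (K + 1))⁻¹ := by
      have h3 : 1 - r ≤ s := by linarith [Real.add_one_le_exp (-s)]
      have hs0 : 0 ≤ s := hpos.le.trans h3
      rw [le_inv_comm₀ hpos (by positivity), ← one_div, le_div_iff₀ hpos]
      calc (100 : ℝ) ^ (K + 1) * (1 - r) ≤ 1 * 100 ^ (K + 1) * s := by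
            rw [one_mul]
            gcongr
        _ ≤ N * 100 ^ (K + 1) * s := by gcongr
        _ ≤ 1 := by linarith
    have h4 := Real.log_le_log hpos hs
    rw [Real.log_inv, Real.log_pow] at h4
    push_cast at h4
    have h5 : (K : ℝ) + 1 ≤ (K + 1) * Real.log 100 :=
      le_mul_of_one_le_right (by positivity) h100
    linarith [neg_le_abs (Real.log (1 - r))]
  have hprod : 1 / (11 * n) * (K + 1) ≤ (1 - r) * max 1 |Real.log (1 - r)| := by
    gcongr
    exact hlog.trans (le_max_right _ _)
  calc _ ≤ 1 / (1 / (11 * n) * (K + 1)) := by gcongr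
    _ = _ := by field_simp

/-- The lower bound with a common multiple `C` of both series. The annuli on which a term of one
of the derivatives dominates cover the disc, up to a disc about `0` in which `10 * C * z` does. -/
theorem weight_mul_le_norm_deriv_add {C : ℝ} (hC : 0 < C) {z : ℂ} (hz : z ∈ ball (0 : ℂ) 1) :
    C / 220 * (1 / ((1 - ‖z‖) * max 1 |Real.log (1 - ‖z‖)|)) ≤
      ‖deriv (lacunarySeries 0 C 1) z‖ + ‖deriv (lacunarySeries (10 * C) C 10) z‖ := by
  have hz1 : ‖z‖ < 1 := by simpa using hz
  have hf0 := norm_nonneg (deriv (lacunarySeries 0 C 1) z)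
  have hg0 := norm_nonneg (deriv (lacunarySeries (10 * C) C 10) z)
  rcases le_or_gt ‖z‖ (Real.exp (-(1 / 100))) with hsmall | hlarge
  · have h1 := le_norm_deriv_lacunarySeries_of_norm_le hC hsmall
    have h2 : (1 : ℝ) / 220 ≤ 1 - ‖z‖ := by
      have h3 : Real.exp (-(1 / 100)) ≤ (101 / 100)⁻¹ := by
        rw [Real.exp_neg]
        gcongr
        linarith [Real.add_one_le_exp (1 / 100 : ℝ)]
      have h4 : ((101 : ℝ) / 100)⁻¹ ≤ 1 - 1 / 220 := by norm_num
      linarith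
    have h5 : 1 / ((1 - ‖z‖) * max 1 |Real.log (1 - ‖z‖)|) ≤ 220 := by
      have h6 : 1 / 220 * 1 ≤ (1 - ‖z‖) * max 1 |Real.log (1 - ‖z‖)| := by
        gcongr
        exact le_max_left _ _
      calc _ ≤ 1 / (1 / 220 * 1 : ℝ) := by gcongr
        _ = 220 := by norm_num
    calc _ ≤ C / 220 * 220 := by gcongr
      _ ≤ _ := by linarith
  · have hzpos : 0 < ‖z‖ := (Real.exp_pos _).trans hlarge
    obtain ⟨s, hs⟩ : ∃ s, ‖z‖ = Real.exp (-s) :=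
      ⟨-Real.log ‖z‖, by rw [neg_neg, Real.exp_log hzpos]⟩
    have hs0 : 0 < s := by
      rw [hs, Real.exp_lt_one_iff] at hz1
      linarith
    have hs1 : s < 1 / 100 := by
      rw [hs, Real.exp_lt_exp] at hlarge
      linarith
    obtain ⟨K, hK1, hK2⟩ := exists_nat_pow_near (x := 1 / (100 * s)) (y := (100 : ℝ))
      (by rw [le_div_iff₀ (by positivity)]; linarith) (by norm_num)
    rw [le_div_iff₀ (by positivity)] at hK1
    rw [div_lt_iff₀ (by positivity)] at hK2
    have hwin : ∀ X : ℝ, 1 / ((1 - ‖z‖) * max 1 |Real.log (1 - ‖z‖)|) ≤ 11 * X →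
        C / 220 * (1 / ((1 - ‖z‖) * max 1 |Real.log (1 - ‖z‖)|)) ≤ C * X / 20 := by
      intro X h
      calc _ ≤ C / 220 * (11 * X) := by gcongr
        _ = _ := by ring
    -- Now `1 / 100 < s * 100 ^ (K + 1) ≤ 1`; from `1 / 10` on `f` is large, below it `g` is.
    rcases le_or_gt (1 / 10) (s * ((1 : ℕ) * 100 ^ (K + 1))) with h | h
    · have hle : s * ((1 : ℕ) * 100 ^ (K + 1)) ≤ 1 := by push_cast; rw [pow_succ]; linarith
      have h1 := le_norm_deriv_lacunarySeries le_rfl hC one_pos (by simpa using hC.le) hs K h hle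
      have h2 := hwin _ (weight_le hs one_pos K h hle)
      linarith
    · have hge : 1 / 10 ≤ s * ((10 : ℕ) * 100 ^ (K + 1)) := by
        push_cast
        rw [pow_succ] at hK2 ⊢
        linarith
      have hle : s * ((10 : ℕ) * 100 ^ (K + 1)) ≤ 1 := by push_cast at h ⊢; linarith
      have h1 := le_norm_deriv_lacunarySeries (A := 10 * C) (by positivity) hC
        (by norm_num : 0 < 10) (by push_cast; linarith) hs K hge hle
      have h2 := hwin _ (weight_le hs (by norm_num : 0 < 10) K hge hle)
      linarith

theorem proposition2p2 (r₀ : ℝ) (hr₀ : 0 < r₀) (hr₀' : r₀ < 1) :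
    ∃ (C : ℝ) (f g : ℂ → ℂ), 0 < C ∧ IsVMOA f ∧ IsVMOA g ∧
      (∀ z ∈ ball (0 : ℂ) 1,
        HasSum (fun j : ℕ => (C : ℂ) * (((j : ℂ) + 1)⁻¹ * z ^ (100 ^ (j + 1)))) (f z)) ∧
      (∀ z ∈ ball (0 : ℂ) 1, r₀ ≤ ‖z‖ →
        1 / ((1 - ‖z‖) * |Real.log (1 - ‖z‖)|) ≤ ‖deriv f z‖ + ‖deriv g z‖) ∧
      (∀ z ∈ ball (0 : ℂ) 1,
        1 / ((1 - ‖z‖) * max 1 |Real.log (1 - ‖z‖)|) ≤ ‖deriv f z‖ + ‖deriv g z‖) := by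
  have hlog0 : Real.log (1 - r₀) < 0 := Real.log_neg (by linarith) (by linarith)
  set L : ℝ := -Real.log (1 - r₀) with hL
  have hL0 : 0 < L := neg_pos.2 hlog0
  -- On `r₀ ≤ |z|` the two weights differ by a factor of at most `max 1 (1 / L)`.
  set M : ℝ := max 1 (1 / L) with hM
  have hM1 : 1 ≤ M := le_max_left _ _
  have hC : 0 < 220 * M := by positivity
  refine ⟨220 * M, lacunarySeries 0 (220 * M) 1, lacunarySeries (10 * (220 * M)) (220 * M) 10, hC,
    isVMOA_lacunarySeries le_rfl hC one_pos,
    isVMOA_lacunarySeries (by positivity) hC (by norm_num), fun z hz => ?_, fun z hz hzr => ?_,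
    fun z hz => ?_⟩
  · simpa using hasSum_lacunarySeries 0 hC.le one_pos hz
  · refine le_trans ?_ (weight_mul_le_norm_deriv_add hC hz)
    have hz1 : 0 < 1 - ‖z‖ := by simpa using hz
    have hlog : L ≤ |Real.log (1 - ‖z‖)| := by
      have := Real.log_le_log hz1 (by linarith : 1 - ‖z‖ ≤ 1 - r₀)
      linarith [neg_le_abs (Real.log (1 - ‖z‖))]
    have hlogpos : 0 < |Real.log (1 - ‖z‖)| := hL0.trans_le hlog
    have hmax : max 1 |Real.log (1 - ‖z‖)| ≤ M * |Real.log (1 - ‖z‖)| := by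
      refine max_le ?_ (le_mul_of_one_le_left hlogpos.le hM1)
      calc (1 : ℝ) = 1 / L * L := by field_simp
        _ ≤ M * |Real.log (1 - ‖z‖)| := by
          gcongr
          exact le_max_right _ _
    calc 1 / ((1 - ‖z‖) * |Real.log (1 - ‖z‖)|)
        = M * (1 / ((1 - ‖z‖) * (M * |Real.log (1 - ‖z‖)|))) := by field_simp
      _ ≤ M * (1 / ((1 - ‖z‖) * max 1 |Real.log (1 - ‖z‖)|)) := by gcongr
      _ = _ := by ring
  · refine le_trans ?_ (weight_mul_le_norm_deriv_add hC hz)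
    have hz1 : 0 < 1 - ‖z‖ := by simpa using hz
    rw [show 220 * M / 220 = M by ring]
    exact le_mul_of_one_le_left (by positivity) hM1
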